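/- Let $\gamma^0,\gamma^1,\gamma^2,\gamma^3$ be Dirac matrices, i.e. complex $4\times 4$ matrices with $\gamma^\mu\gamma^\nu+\gamma^\nu\gamma^\mu=2g^{\mu\nu}$, $g=\mathrm{diag}(1,-1,-1,-1)$, $\gamma^0$ Hermitian and $\vec\gamma=(\gamma^1,\gamma^2,\gamma^3)$ anti-Hermitian. Let $e,m\in\mathbb R$, $c,\hbar>0$, and let $A=(A_\mu):\mathbb R^4\to\mathbb R^4$ be an (arbitrary) real external potential. Let $$\mathcal P=\{\lambda=(y,\vec\alpha,\vec\varphi): y=(y^0,\vec y)\in\mathbb R\times\mathbb R^3,\ \vec\alpha,\vec\varphi\in\mathbb R^3,\ |\vec\alpha|<1,\ |\vec\varphi|<\pi\}.$$ For $\lambda\in\mathcal P$ let $\hat R_{\vec\varphi}\in SO(3)$ be the right-handed rotation by the angle $|\vec\varphi|$ around $\vec\varphi/|\vec\varphi|$ (the identity if $\vec\varphi=0$), and put, for $\vec u\in\mathbb R^3$ and $f,g:\mathbb R^3\to\mathbb C^4$, $$\sigma_\lambda(\vec u)=\bigl(y^0+\vec\alpha\cdot\hat R_{\vec\varphi}\vec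 u,\ \vec y+\hat R_{\vec\varphi}\vec u\bigr),\qquad \langle f|g\rangle_\lambda=\int_{\mathbb R^3} f^+(\vec u)\,(1-\gamma^0\,\vec\gamma\cdot\vec\alpha)\,g(\vec u)\,d\vec u,\qquad \|f\|_\lambda=\sqrt{\langle f|f\rangle_\lambda}\in[0,\infty].$$ Let $\hat H$ be the set of all continuously differentiable $\Psi:\mathbb R\times\mathbb R^3\to\mathbb C^4$ that satisfy the Dirac equation $$\Bigl(i\gamma^\mu\partial_\mu-\tfrac{e}{c\hbar}\gamma^\mu A_\mu-\tfrac{mc}{\hbar}\Bigr)\Psi(x)=0\quad\text{for all }x$$ and, for every $\lambda\in\mathcal P$, both $\|\Psi\circ\sigma_\lambda\|_\lambda<\infty$ and $\lim_{|\vec u|\to\infty}|\vec u|^3\,|\Psi\circ\sigma_\lambda(\vec u)|^2=0$. **Theorem.** Let $\Psi_A,\Psi_B\in\hat H$ and $j_{AB}^\mu=\Psi_A^+\gamma^0\gamma^\mu\Psi_B$. Then for every $\lambda=(y,\vec\alpha,\vec\varphi)\in\mathcal P$ the quantity $$\langle\Psi_A\circ\sigma_\lambda|\Psi_B\circ\sigma_\lambda\rangle_\lambda=\int_{\sigma_\lambda}j_{AB}^\mu\,df_\mu,\qquad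 df_\mu=(1,-\vec\alpha)\,d\vec u,$$ exists (both integrals converge absolutely, and they are equal), and it is independent of $\lambda\in\mathcal P$. -/

import Mathlib

open MeasureTheory Filter Topology Matrix
open scoped ENNReal

noncomputable section

/-- Euclidean three-space. -/
abbrev Space : Type := EuclideanSpace ℝ (Fin 3)

/-- Space-time `ℝ × ℝ³`, with points `x = (x⁰, x⃗)`. -/
abbrev Spacetime : Type := ℝ × Space

/-- The spinor space `ℂ⁴` with its Hermitian norm. -/
abbrev Spinor : Type := EuclideanSpace ℂ (Fin 4)

/-- A quadruple of complex `4 × 4` matrices, `γ 0 = γ⁰` and `γ k.succ = γᵏ⁺¹` for `k : Fin 3`. -/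
abbrev GammaMatrices : Type := Fin 4 → Matrix (Fin 4) (Fin 4) ℂ

/-- The Minkowski metric `diag (1, -1, -1, -1)`. -/
def minkowski : Matrix (Fin 4) (Fin 4) ℂ := Matrix.diagonal ![1, -1, -1, -1]

/-- `γ` is a quadruple of Dirac matrices: the anticommutation relations
`γ^μ γ^ν + γ^ν γ^μ = 2 g^{μν}`, with `γ⁰` Hermitian and `γ¹, γ², γ³` anti-Hermitian. -/
structure IsDiracMatrices (γ : GammaMatrices) : Prop where
  anticomm : ∀ μ ν, γ μ * γ ν + γ ν * γ μ = (2 * minkowski μ ν) • 1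
  hermitian_zero : (γ 0)ᴴ = γ 0
  antihermitian_succ : ∀ k : Fin 3, (γ k.succ)ᴴ = -γ k.succ

/-- The Dirac matrices in the Dirac representation. -/
def diracGamma : GammaMatrices :=
  ![!![1, 0, 0, 0; 0, 1, 0, 0; 0, 0, -1, 0; 0, 0, 0, -1],
    !![0, 0, 0, 1; 0, 0, 1, 0; 0, -1, 0, 0; -1, 0, 0, 0],
    !![0, 0, 0, -Complex.I; 0, 0, Complex.I, 0; 0, Complex.I, 0, 0; -Complex.I, 0, 0, 0],
    !![0, 0, 1, 0; 0, 0, 0, -1; -1, 0, 0, 0; 0, 1, 0, 0]]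

/-- The Dirac representation is an instance of the definition above. -/
theorem isDiracMatrices_diracGamma : IsDiracMatrices diracGamma where
  anticomm μ ν := by
    have one4 : (1 : Matrix (Fin 4) (Fin 4) ℂ) =
        !![1, 0, 0, 0; 0, 1, 0, 0; 0, 0, 1, 0; 0, 0, 0, 1] := by
      ext i j
      fin_cases i <;> fin_cases j <;> simp
    have zero4 : !![0, 0, 0, 0; 0, 0, 0, 0; 0, 0, 0, 0; 0, 0, 0, 0] =
        (0 : Matrix (Fin 4) (Fin 4) ℂ) := by
      ext i j
      fin_cases i <;> fin_cases j <;> rfl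
    rw [one4]
    fin_cases μ <;> fin_cases ν <;>
      simp [diracGamma, minkowski, one_add_one_eq_two, zero4, ← neg_add]
  hermitian_zero := by
    ext i j
    fin_cases i <;> fin_cases j <;> simp [diracGamma]
  antihermitian_succ k := by
    ext i j
    fin_cases k <;> fin_cases i <;> fin_cases j <;> simp [diracGamma]

/-- The parameter set `𝒫` of triples `(y, α, φ)` with `|α| < 1` and `|φ| < π`. -/
structure HyperplaneParam where
  /-- the base point `y = (y⁰, y⃗)` -/
  y : Spacetime
  /-- the slope -/
  α : Space
  /-- the rotation vector -/
  φ : Space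
  norm_α_lt : ‖α‖ < 1
  norm_φ_lt : ‖φ‖ < Real.pi

/-- The vector product on `ℝ³`. -/
def cross (a b : Space) : Space :=
  WithLp.toLp 2 (crossProduct a.ofLp b.ofLp)

/-- The rotation by the angle `|φ|` around `n = φ / |φ|` in the right-handed sense,
`u ↦ cos |φ| u + sin |φ| (n × u) + (1 - cos |φ|) (n · u) n`. For `φ = 0` it is the identity. -/
def rotate (φ u : Space) : Space :=
  Real.cos ‖φ‖ • u + Real.sin ‖φ‖ • cross (‖φ‖⁻¹ • φ) u
    + ((1 - Real.cos ‖φ‖) * inner ℝ (‖φ‖⁻¹ • φ) u) • (‖φ‖⁻¹ • φ)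

/-- The parametrized flat spacelike hyperplane
`σ_lam (u) = (y⁰ + α · R_φ u, y⃗ + R_φ u)`. -/
def hyperplane (lam : HyperplaneParam) (u : Space) : Spacetime :=
  (lam.y.1 + inner ℝ lam.α (rotate lam.φ u), lam.y.2 + rotate lam.φ u)

/-- `f⁺ (1 - γ⁰ γ⃗ · α) g` for two spinors `f` and `g`. -/
def braketDensity (γ : GammaMatrices) (α : Space) (f g : Spinor) : ℂ :=
  star f.ofLp ⬝ᵥ ((1 - γ 0 * ∑ k : Fin 3, (α k : ℂ) • γ k.succ) *ᵥ g.ofLp)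

/-- `⟨f | g⟩_lam = ∫ f⁺(u) (1 - γ⁰ γ⃗ · α) g(u) du`. -/
def braket (γ : GammaMatrices) (lam : HyperplaneParam) (f g : Space → Spinor) : ℂ :=
  ∫ u, braketDensity γ lam.α (f u) (g u)

/-- `‖f‖_lam = √⟨f | f⟩_lam`, with the value `∞` if the integral diverges. (The integrand
`f⁺(u) (1 - γ⁰ γ⃗ · α) f(u)` is real and nonnegative because `|α| < 1`.) -/
def hyperplaneNorm (γ : GammaMatrices) (lam : HyperplaneParam) (f : Space → Spinor) : ℝ≥0∞ :=
  (∫⁻ u, ENNReal.ofReal (braketDensity γ lam.α (f u) (f u)).re) ^ (1 / 2 : ℝ)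

/-- The `μ`-th coordinate vector of space-time. -/
def basisVec : Fin 4 → Spacetime :=
  Fin.cons (1, 0) fun k : Fin 3 => (0, EuclideanSpace.single k 1)

/-- The partial derivative `∂_μ Ψ (x)`. -/
def partialDeriv (μ : Fin 4) (Ψ : Spacetime → Spinor) (x : Spacetime) : Spinor :=
  fderiv ℝ Ψ x (basisVec μ)

/-- The Dirac equation `(i γ^μ ∂_μ - e/(cħ) γ^μ A_μ - mc/ħ) Ψ (x) = 0` at every `x`. -/
def DiracEquation (γ : GammaMatrices) (e c ħ m : ℝ) (A : Spacetime → Fin 4 → ℝ)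
    (Ψ : Spacetime → Spinor) : Prop :=
  ∀ x, (∑ μ, Complex.I • (γ μ *ᵥ (partialDeriv μ Ψ x).ofLp))
      - ((e / (c * ħ) : ℝ) : ℂ) • (∑ μ, (A x μ : ℂ) • (γ μ *ᵥ (Ψ x).ofLp))
      - ((m * c / ħ : ℝ) : ℂ) • (Ψ x).ofLp = 0

/-- The space `Ĥ`: continuously differentiable solutions `Ψ` of the Dirac equation such that for
every hyperplane `‖Ψ ∘ σ_lam‖_lam < ∞` and `|u|³ |Ψ ∘ σ_lam (u)|² → 0` as `|u| → ∞`. -/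
structure MemHHat (γ : GammaMatrices) (e c ħ m : ℝ) (A : Spacetime → Fin 4 → ℝ)
    (Ψ : Spacetime → Spinor) : Prop where
  contDiff : ContDiff ℝ 1 Ψ
  dirac : DiracEquation γ e c ħ m A Ψ
  norm_lt_top : ∀ lam, hyperplaneNorm γ lam (Ψ ∘ hyperplane lam) < ∞
  decay : ∀ lam, Tendsto (fun u : Space => ‖u‖ ^ 3 * ‖(Ψ ∘ hyperplane lam) u‖ ^ 2)
    (cocompact Space) (𝓝 0)

/-- The current `j_{AB}^μ = Ψ_A⁺ γ⁰ γ^μ Ψ_B`. -/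
def current (γ : GammaMatrices) (ΨA ΨB : Spacetime → Spinor) (μ : Fin 4) (x : Spacetime) : ℂ :=
  star (ΨA x).ofLp ⬝ᵥ ((γ 0 * γ μ) *ᵥ (ΨB x).ofLp)

/-- The covector `(1, -α)`, so that the surface element of `σ_lam` is `df_μ = (1, -α)_μ du`. -/
def surfaceCovector (lam : HyperplaneParam) : Fin 4 → ℝ :=
  Fin.cons 1 fun k : Fin 3 => -lam.α k

/-- The integrand of the flux integral in the parameter `u`: `j^μ (σ_lam (u)) (1, -α)_μ`. -/
def fluxDensity (j : Fin 4 → Spacetime → ℂ) (lam : HyperplaneParam) (u : Space) : ℂ :=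
  ∑ μ, j μ (hyperplane lam u) * (surfaceCovector lam μ : ℂ)

/-- The flux integral `∫_{σ_lam} j^μ df_μ`. -/
def flux (j : Fin 4 → Spacetime → ℂ) (lam : HyperplaneParam) : ℂ :=
  ∫ u, fluxDensity j lam u

end

/-! For a single solution the current is real, divergence-free and causal: the velocity matrix `γ⁰
γ⃗·v` is Hermitian with square `|v|²`, so `|v·j| ≤ |v| ρ`. Every hyperplane is the graph of an
affine function over space, and two such graphs are joined by linear interpolation in a parameter `s
∈ [0,1]`. Pulling the current back along this family gives a divergence-free field `(J₀, J)` on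
`[0,1] × ℝ³` whose density `J₀` is the flux density through the interpolated plane.

The interpolated planes separate linearly in `|x|`, so a flow line `dx/ds = J/J₀` moves at most
exponentially in `s`. A cutoff domain shrinking exponentially in `s` is therefore never entered by
flow lines, and the charge in it does not increase (`integral_density_le`). Enlarging the domain
compares the fluxes through the end planes (`integral_graph_flux_le`); exchanging the planes gives
equality. Integrability is needed only on the two end planes.

Two different solutions are handled by polarization: `Ψ + Ψ'` gives the real part of the bracket,
and replacing `Ψ` by `iΨ` gives the imaginary part. -/

/-! ### Cutoff functions. -/

/-- A smooth decreasing function equal to `1` up to `1` and to `0` from `2` on. -/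
noncomputable def smoothDrop (r : ℝ) : ℝ := Real.smoothTransition (2 - r)

theorem contDiff_smoothDrop : ContDiff ℝ 1 smoothDrop :=
  Real.smoothTransition.contDiff.comp (contDiff_const.sub contDiff_id)

theorem deriv_smoothDrop_nonpos (r : ℝ) : deriv smoothDrop r ≤ 0 := by
  have : Antitone smoothDrop := fun a b h => Real.smoothTransition.monotone (by linarith)
  exact this.deriv_nonpos

theorem smoothDrop_eq_one {r : ℝ} (h : r ≤ 1) : smoothDrop r = 1 :=
  Real.smoothTransition.one_of_one_le (by linarith)

theorem smoothDrop_eq_zero {r : ℝ} (h : 2 ≤ r) : smoothDrop r = 0 :=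
  Real.smoothTransition.zero_of_nonpos (by linarith)

/-- A spatial cutoff at radius about `n + 1` that shrinks exponentially in the first variable. -/
noncomputable def shrinkingCutoff (K : ℝ) (n : ℕ) (p : Spacetime) : ℝ :=
  smoothDrop (Real.exp (K * p.1) * (1 + ‖p.2‖ ^ 2) / ((n : ℝ) + 1) ^ 2)

theorem contDiff_shrinkingCutoff (K : ℝ) (n : ℕ) : ContDiff ℝ 1 (shrinkingCutoff K n) := by
  refine contDiff_smoothDrop.comp (ContDiff.div_const (ContDiff.mul ?_ ?_) _)
  · exact (contDiff_const.mul contDiff_fst).exp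
  · exact contDiff_const.add (contDiff_snd.norm_sq ℝ)

theorem shrinkingCutoff_eq_zero {K : ℝ} (hK : 0 ≤ K) {n : ℕ} {p : Spacetime} (h0 : 0 ≤ p.1)
    (hp : 2 * ((n : ℝ) + 1) ≤ ‖p.2‖) : shrinkingCutoff K n p = 0 := by
  apply smoothDrop_eq_zero
  rw [le_div_iff₀ (by positivity)]
  have h1 : 1 ≤ Real.exp (K * p.1) := Real.one_le_exp (by positivity)
  have h2 : (2 * ((n : ℝ) + 1)) ^ 2 ≤ ‖p.2‖ ^ 2 := by gcongr
  nlinarith [sq_nonneg ‖p.2‖]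

theorem norm_shrinkingCutoff_le (K : ℝ) (n : ℕ) (p : Spacetime) :
    ‖shrinkingCutoff K n p‖ ≤ 1 := by
  rw [shrinkingCutoff, smoothDrop, Real.norm_of_nonneg (Real.smoothTransition.nonneg _)]
  exact Real.smoothTransition.le_one _

theorem tendsto_shrinkingCutoff (K : ℝ) (p : Spacetime) :
    Tendsto (fun n => shrinkingCutoff K n p) atTop (𝓝 1) := by
  have h : Tendsto (fun n : ℕ =>
      Real.exp (K * p.1) * (1 + ‖p.2‖ ^ 2) / ((n : ℝ) + 1) ^ 2) atTop (𝓝 0) := by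
    apply Tendsto.const_div_atTop
    exact (tendsto_pow_atTop two_ne_zero).comp
      (tendsto_atTop_add_const_right _ _ tendsto_natCast_atTop_atTop)
  apply tendsto_const_nhds.congr'
  filter_upwards [h.eventually_le_const one_pos] with n hn
  exact (smoothDrop_eq_one hn).symm

/-- All directional derivatives share one factor `d ≤ 0`, so the sign of the derivative along a
field is decided by the field's radial part against `K (1 + |x|²)` times its density. -/
theorem fderiv_shrinkingCutoff (K : ℝ) (n : ℕ) (p : Spacetime) :
    ∃ d ≤ 0, ∀ v : Spacetime, fderiv ℝ (shrinkingCutoff K n) p v =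
      d * (K * (1 + ‖p.2‖ ^ 2) * v.1 + 2 * inner ℝ p.2 v.2) := by
  refine ⟨deriv smoothDrop (Real.exp (K * p.1) * (1 + ‖p.2‖ ^ 2) / ((n : ℝ) + 1) ^ 2) *
    (Real.exp (K * p.1) / ((n : ℝ) + 1) ^ 2),
    mul_nonpos_of_nonpos_of_nonneg (deriv_smoothDrop_nonpos _) (by positivity), fun v => ?_⟩
  have hs : HasFDerivAt (fun q : Spacetime => ‖q.2‖ ^ 2)
      (2 • (innerSL ℝ p.2).comp (ContinuousLinearMap.snd ℝ ℝ Space)) p :=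
    HasFDerivAt.norm_sq (f := Prod.snd) hasFDerivAt_snd
  have he : HasFDerivAt (fun q : Spacetime => Real.exp (K * q.1))
      (Real.exp (K * p.1) • K • ContinuousLinearMap.fst ℝ ℝ Space) p :=
    (hasFDerivAt_fst.const_mul K).exp
  have h := ((he.mul (hs.const_add 1)).mul_const ((((n : ℝ) + 1) ^ 2)⁻¹))
  have hd : HasDerivAt smoothDrop _ _ := ((contDiff_smoothDrop.differentiable one_ne_zero)
    (Real.exp (K * p.1) * (1 + ‖p.2‖ ^ 2) * (((n : ℝ) + 1) ^ 2)⁻¹)).hasDerivAt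
  have hχ : HasFDerivAt (shrinkingCutoff K n) _ p := hd.comp_hasFDerivAt p h
  rw [hχ.fderiv]
  simp [div_eq_mul_inv]
  ring

/-! ### Integration over time slices and the one-sided charge estimate. -/

theorem fderiv_comp_prodMk_apply {f : Spacetime → ℝ} (hf : ContDiff ℝ 1 f) (s : ℝ) (x v : Space) :
    fderiv ℝ (fun x => f (s, x)) x v = fderiv ℝ f (s, x) (0, v) := by
  have h := ((hf.differentiable one_ne_zero) (s, x)).hasFDerivAt.comp x
    (hasFDerivAt_prodMk_right s x)
  exact congrArg (fun L => L v) h.fderiv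

theorem integral_fderiv_slice_eq_zero {f : Spacetime → ℝ} (hf : ContDiff ℝ 1 f) {s r : ℝ}
    (h0 : ∀ x : Space, r ≤ ‖x‖ → f (s, x) = 0) (v : Space) :
    ∫ x, fderiv ℝ f (s, x) (0, v) = 0 := by
  have hg : ContDiff ℝ 1 fun x : Space => f (s, x) := hf.comp (contDiff_prodMk_right s)
  have hc : HasCompactSupport fun x : Space => f (s, x) :=
    HasCompactSupport.intro (isCompact_closedBall 0 r) fun x hx => h0 x (by
      simp only [Metric.mem_closedBall, dist_zero_right, not_le] at hx; exact hx.le)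
  have hgi : Integrable fun x : Space => f (s, x) := hg.continuous.integrable_of_hasCompactSupport hc
  have hd : Integrable fun x => fderiv ℝ (fun x : Space => f (s, x)) x v :=
    ((hg.continuous_fderiv one_ne_zero).clm_apply continuous_const).integrable_of_hasCompactSupport
      (hc.fderiv_apply ℝ v)
  -- Integration by parts against the constant `1`.
  have := integral_mul_fderiv_eq_neg_fderiv_mul_of_integrable (μ := volume) (v := v)
    (f := fun _ : Space => (1 : ℝ)) (g := fun x : Space => f (s, x)) (by simp)
    (by simpa using hd) (by simpa using hgi) (by fun_prop)
    (fun x _ => hg.differentiable one_ne_zero x)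
  simpa [fderiv_comp_prodMk_apply hf] using this

theorem integral_slice_sub {f : Spacetime → ℝ} (hf : ContDiff ℝ 1 f) {r : ℝ}
    (h0 : ∀ s ∈ Set.Icc (0 : ℝ) 1, ∀ x : Space, r ≤ ‖x‖ → f (s, x) = 0) :
    (∫ x, f (1, x)) - ∫ x, f (0, x)
      = ∫ s in Set.Ioc (0 : ℝ) 1, ∫ x, fderiv ℝ f (s, x) (1, 0) := by
  have hcont : Continuous fun p => fderiv ℝ f p (1, 0) :=
    (hf.continuous_fderiv one_ne_zero).clm_apply continuous_const
  have hderiv : ∀ (s : ℝ) (x : Space),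
      HasDerivAt (fun s => f (s, x)) (fderiv ℝ f (s, x) (1, 0)) s := fun s x =>
    (((hf.differentiable one_ne_zero) (s, x)).hasFDerivAt.comp_hasDerivAt s
      ((hasDerivAt_id s).prodMk (hasDerivAt_const s x)))
  have hftc : ∀ x : Space,
      ∫ s in Set.Ioc (0 : ℝ) 1, fderiv ℝ f (s, x) (1, 0) = f (1, x) - f (0, x) := fun x => by
    rw [← intervalIntegral.integral_of_le zero_le_one]
    exact intervalIntegral.integral_eq_sub_of_hasDerivAt (fun s _ => hderiv s x)
      ((hcont.comp (by fun_prop : Continuous fun s : ℝ => (s, x))).intervalIntegrable _ _)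
  -- The `s`-derivative vanishes far out only where `f` vanishes for all nearby times, hence the
  -- open interval; the endpoints are a null set.
  have hzero : ∀ s ∈ Set.Ioo (0 : ℝ) 1, ∀ x : Space, r ≤ ‖x‖ →
      fderiv ℝ f (s, x) (1, 0) = 0 := fun s hs x hx => by
    rw [← (hderiv s x).deriv]
    have : (fun s => f (s, x)) =ᶠ[𝓝 s] fun _ => 0 := by
      filter_upwards [Icc_mem_nhds hs.1 hs.2] with t ht using h0 t ht x hx
    rw [this.deriv_eq, deriv_const]
  have hint : Integrable (fun p => fderiv ℝ f p (1, 0))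
      ((volume.restrict (Set.Ioc (0 : ℝ) 1)).prod (volume : Measure Space)) := by
    rw [restrict_Ioo_eq_restrict_Ioc.symm]
    have h1 : IntegrableOn (fun p => fderiv ℝ f p (1, 0))
        (Set.Ioo (0 : ℝ) 1 ×ˢ Metric.closedBall (0 : Space) r) :=
      (hcont.continuousOn.integrableOn_compact
        (isCompact_Icc.prod (isCompact_closedBall 0 r))).mono_set
          (Set.prod_mono_left Set.Ioo_subset_Icc_self)
    have h2 : IntegrableOn (fun p => fderiv ℝ f p (1, 0))
        (Set.Ioo (0 : ℝ) 1 ×ˢ (Set.univ : Set Space)) :=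
      h1.of_forall_sdiff_eq_zero (measurableSet_Ioo.prod MeasurableSet.univ) fun p hp =>
        hzero p.1 hp.1.1 p.2 (by
          by_contra hlt
          exact hp.2 ⟨hp.1.1, by simpa using (not_le.1 hlt).le⟩)
    rwa [IntegrableOn, Measure.volume_eq_prod, ← Measure.prod_restrict,
      Measure.restrict_univ] at h2
  have hi : ∀ s ∈ Set.Icc (0 : ℝ) 1, Integrable fun x => f (s, x) := fun s hs =>
    (hf.continuous.comp (by fun_prop : Continuous fun x : Space => (s, x)))
      |>.integrable_of_hasCompactSupport
      (HasCompactSupport.intro (isCompact_closedBall 0 r) fun x hx => h0 s hs x (by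
        simp only [Metric.mem_closedBall, dist_zero_right, not_le] at hx; exact hx.le))
  rw [← integral_sub (hi 1 (by simp)) (hi 0 (by simp)), integral_integral_swap hint]
  simp only [hftc]

/-- A divergence-free field whose radial part grows at most quadratically relative to its density
does not let the total charge increase. -/
theorem integral_density_le {J₀ : Spacetime → ℝ} {J : Fin 3 → Spacetime → ℝ}
    (h₀ : ContDiff ℝ 1 J₀) (hJ : ∀ k, ContDiff ℝ 1 (J k))
    (hdiv : ∀ p, fderiv ℝ J₀ p (1, 0)
      + ∑ k, fderiv ℝ (J k) p (0, EuclideanSpace.single k 1) = 0)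
    {C : ℝ} (hC : 0 ≤ C)
    (hbound : ∀ p : Spacetime, p.1 ∈ Set.Icc (0 : ℝ) 1 →
      |∑ k, p.2 k * J k p| ≤ C * (1 + ‖p.2‖ ^ 2) * J₀ p)
    (hi0 : Integrable fun x => J₀ (0, x)) (hi1 : Integrable fun x => J₀ (1, x)) :
    ∫ x, J₀ (1, x) ≤ ∫ x, J₀ (0, x) := by
  have hlim : ∀ s, (Integrable fun x => J₀ (s, x)) →
      Tendsto (fun n => ∫ x, shrinkingCutoff (2 * C) n (s, x) * J₀ (s, x)) atTop
        (𝓝 (∫ x, J₀ (s, x))) := fun s hs => by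
    refine tendsto_integral_of_dominated_convergence (fun x => ‖J₀ (s, x)‖) (fun n => ?_) hs.norm
      (fun n => .of_forall fun x => ?_) (.of_forall fun x => ?_)
    · exact (((contDiff_shrinkingCutoff _ n).continuous.mul h₀.continuous).comp
        (by fun_prop : Continuous fun x : Space => (s, x))).aestronglyMeasurable
    · rw [norm_mul]
      exact mul_le_of_le_one_left (norm_nonneg _) (norm_shrinkingCutoff_le _ _ _)
    · simpa using (tendsto_shrinkingCutoff (2 * C) (s, x)).mul_const (J₀ (s, x))
  refine le_of_tendsto_of_tendsto' (hlim 1 hi1) (hlim 0 hi0) fun n => ?_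
  -- Along a flow line `d/ds log (1 + |x|²) = 2 x·J / (J₀ (1 + |x|²)) ≥ -2C`. With rate `2C`, the
  -- argument of the cutoff cannot decrease along the flow, so `χ` cannot increase.
  set χ := shrinkingCutoff (2 * C) n with hχ
  have hχc : ContDiff ℝ 1 χ := contDiff_shrinkingCutoff _ n
  have hz : ∀ s ∈ Set.Icc (0 : ℝ) 1, ∀ x : Space, 2 * ((n : ℝ) + 1) ≤ ‖x‖ → χ (s, x) = 0 :=
    fun s hs x hx => shrinkingCutoff_eq_zero (by positivity) hs.1 hx
  have hsub := integral_slice_sub (hχc.mul h₀) (r := 2 * ((n : ℝ) + 1))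
    fun s hs x hx => by simp [hz s hs x hx]
  rw [← sub_nonpos, hsub]
  refine setIntegral_nonpos measurableSet_Ioc fun s hs => ?_
  have hs' : s ∈ Set.Icc (0 : ℝ) 1 := Set.Ioc_subset_Icc_self hs
  have hprod : ∀ {g : Spacetime → ℝ}, ContDiff ℝ 1 g → ∀ p v, fderiv ℝ (χ * g) p v
      = χ p * fderiv ℝ g p v + g p * fderiv ℝ χ p v := fun hg p v => by
    rw [fderiv_mul (hχc.differentiable one_ne_zero p) (hg.differentiable one_ne_zero p)]
    simp
  have hzero : ∀ k, ∫ x, fderiv ℝ (χ * J k) (s, x) (0, EuclideanSpace.single k 1) = 0 := fun k =>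
    integral_fderiv_slice_eq_zero (f := χ * J k) (r := 2 * ((n : ℝ) + 1)) (hχc.mul (hJ k))
      (fun x hx => by simp [hz s hs' x hx]) _
  -- The space-time divergence of `χ (J₀, J)` is the derivative of `χ` along the field, since the
  -- field itself is divergence-free.
  have hneg : ∀ x, fderiv ℝ (χ * J₀) (s, x) (1, 0)
      + ∑ k, fderiv ℝ (χ * J k) (s, x) (0, EuclideanSpace.single k 1) ≤ 0 := fun x => by
    obtain ⟨d, hd, hfd⟩ := fderiv_shrinkingCutoff (2 * C) n (s, x)
    rw [← hχ] at hfd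
    have e : fderiv ℝ (χ * J₀) (s, x) (1, 0)
        + ∑ k, fderiv ℝ (χ * J k) (s, x) (0, EuclideanSpace.single k 1)
        = χ (s, x) * (fderiv ℝ J₀ (s, x) (1, 0)
          + ∑ k, fderiv ℝ (J k) (s, x) (0, EuclideanSpace.single k 1))
          + 2 * d * (C * (1 + ‖x‖ ^ 2) * J₀ (s, x) + ∑ k, x k * J k (s, x)) := by
      simp only [hprod h₀, hprod (hJ _), hfd, Fin.sum_univ_three, EuclideanSpace.inner_single_right]
      simp
      ring
    rw [e, hdiv, mul_zero, zero_add]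
    have := (abs_le.1 (hbound (s, x) hs')).1
    exact mul_nonpos_of_nonpos_of_nonneg (by linarith) (by simp only at this; linarith)
  have hcs : ∀ {g : Spacetime → ℝ}, ContDiff ℝ 1 g → ∀ v : Space,
      Integrable fun x => fderiv ℝ (χ * g) (s, x) (0, v) := fun {g} hg v => by
    have hc : HasCompactSupport fun x : Space => (χ * g) (s, x) :=
      HasCompactSupport.intro (isCompact_closedBall 0 (2 * ((n : ℝ) + 1))) fun x hx => by
        simp only [Metric.mem_closedBall, dist_zero_right, not_le] at hx
        simp [hz s hs' x hx.le]
    have := ((((hχc.mul hg).continuous_fderiv one_ne_zero).clm_apply continuous_const).comp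
      (by fun_prop : Continuous fun x : Space => (s, x))).integrable_of_hasCompactSupport
        (μ := volume) (f := fun x => fderiv ℝ (χ * g) (s, x) (0, v))
        ((funext fun x => fderiv_comp_prodMk_apply (f := χ * g) (hχc.mul hg) s x v) ▸
          hc.fderiv_apply ℝ v)
    exact this
  by_cases hit : Integrable fun x => fderiv ℝ (χ * J₀) (s, x) (1, 0)
  · have := integral_nonpos (μ := (volume : Measure Space)) (f := fun x => _) hneg
    rw [integral_add hit (integrable_finsetSum _ fun k _ => hcs (hJ k) _),
      integral_finsetSum _ fun k _ => hcs (hJ k) _, Finset.sum_eq_zero fun k _ => hzero k,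
      add_zero] at this
    exact this
  -- A non-integrable integrand has integral `0` by convention, which suffices for the inequality.
  · exact (integral_undef hit).le

/-! ### Flux comparison between affine graphs. -/

/-- Transport of a divergence-free causal current between two spacelike hyperplanes, given as
graphs of affine functions. -/
theorem integral_graph_flux_le {ρ : Spacetime → ℝ} {j : Fin 3 → Spacetime → ℝ}
    (hρ : ContDiff ℝ 1 ρ) (hj : ∀ k, ContDiff ℝ 1 (j k))
    (hdiv : ∀ p, fderiv ℝ ρ p (1, 0)
      + ∑ k, fderiv ℝ (j k) p (0, EuclideanSpace.single k 1) = 0)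
    (hcausal : ∀ (p : Spacetime) (v : Space), |∑ k, v k * j k p| ≤ ‖v‖ * ρ p)
    {a₀ a₁ : ℝ} {β₀ β₁ : Space} (hβ₀ : ‖β₀‖ < 1) (hβ₁ : ‖β₁‖ < 1)
    (hi₀ : Integrable fun x : Space => ρ (a₀ + inner ℝ β₀ x, x)
      - ∑ k, β₀ k * j k (a₀ + inner ℝ β₀ x, x))
    (hi₁ : Integrable fun x : Space => ρ (a₁ + inner ℝ β₁ x, x)
      - ∑ k, β₁ k * j k (a₁ + inner ℝ β₁ x, x)) :
    ∫ x : Space, (ρ (a₁ + inner ℝ β₁ x, x) - ∑ k, β₁ k * j k (a₁ + inner ℝ β₁ x, x))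
      ≤ ∫ x : Space, (ρ (a₀ + inner ℝ β₀ x, x) - ∑ k, β₀ k * j k (a₀ + inner ℝ β₀ x, x)) := by
  obtain ⟨δ, hδ⟩ : ∃ δ, δ = β₁ - β₀ := ⟨_, rfl⟩
  set β : ℝ → Space := fun s => β₀ + s • δ with hβ
  -- `V` is the `s`-derivative of the time component of `Φ`. It may change sign: the planes may
  -- intersect, and `Φ` need not be injective.
  set V : Spacetime → ℝ := fun p => (a₁ - a₀) + inner ℝ δ p.2 with hV
  set Φ : Spacetime → Spacetime :=
    fun p => (a₀ + p.1 * (a₁ - a₀) + inner ℝ (β p.1) p.2, p.2) with hΦ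
  have hβd : ContDiff ℝ 1 fun p : Spacetime => β p.1 := by fun_prop
  have hVd : ContDiff ℝ 1 V := contDiff_const.add (contDiff_const.inner ℝ contDiff_snd)
  have hΦd : ContDiff ℝ 1 Φ := by
    refine ContDiff.prodMk (ContDiff.add (by fun_prop) (hβd.inner ℝ contDiff_snd)) contDiff_snd
  have hβkd : ∀ k, ContDiff ℝ 1 fun p : Spacetime => β p.1 k := fun k =>
    (EuclideanSpace.proj (𝕜 := ℝ) k).contDiff.comp hβd
  have hβf : ∀ p : Spacetime, HasFDerivAt (fun p : Spacetime => β p.1)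
      ((ContinuousLinearMap.fst ℝ ℝ Space).smulRight δ) p := fun p =>
    (hasFDerivAt_fst.smul_const δ).const_add β₀
  have hβk : ∀ k (p w : Spacetime),
      fderiv ℝ (fun p : Spacetime => β p.1 k) p w = w.1 * δ k := fun k p w => by
    have := ((EuclideanSpace.proj (𝕜 := ℝ) k).hasFDerivAt.comp p (hβf p)).fderiv
    refine (congrArg (fun L => L w) this).trans ?_
    simp
  have hVf : ∀ (p w : Spacetime), fderiv ℝ V p w = inner ℝ δ w.2 := fun p w => by
    have : HasFDerivAt V ((innerSL ℝ δ).comp (ContinuousLinearMap.snd ℝ ℝ Space)) p :=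
      ((innerSL ℝ δ).hasFDerivAt.comp p hasFDerivAt_snd).const_add _
    rw [this.fderiv]
    simp
  have hΦf : ∀ (p w : Spacetime),
      fderiv ℝ Φ p w = (w.1 * V p + inner ℝ (β p.1) w.2, w.2) := fun p w => by
    have h0 : HasFDerivAt (fun p : Spacetime => p.1) (ContinuousLinearMap.fst ℝ ℝ Space) p :=
      hasFDerivAt_fst
    have h1 : HasFDerivAt (fun p : Spacetime => a₀ + p.1 * (a₁ - a₀)) _ p :=
      (h0.mul_const (a₁ - a₀)).const_add a₀
    have h : HasFDerivAt Φ _ p :=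
      (h1.add ((hβf p).inner ℝ hasFDerivAt_snd)).prodMk hasFDerivAt_snd
    rw [h.fderiv]
    ext
    · simp [hV, real_inner_smul_left]
      ring
    · simp
  have hcomp : ∀ {g : Spacetime → ℝ}, ContDiff ℝ 1 g → ∀ p τ v,
      fderiv ℝ (fun p => g (Φ p)) p (τ, v) = (τ * V p + inner ℝ (β p.1) v) * fderiv ℝ g (Φ p) (1, 0)
        + fderiv ℝ g (Φ p) (0, v) := fun {g} hg p τ v => by
    have : fderiv ℝ (fun p => g (Φ p)) p = _ :=
      fderiv_comp p (hg.differentiable one_ne_zero _) (hΦd.differentiable one_ne_zero p)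
    have e : ∀ c : ℝ, ((c, v) : Spacetime) = c • (1, 0) + (0, v) := fun c => by simp
    rw [this, ContinuousLinearMap.comp_apply, hΦf, e, map_add, map_smul, smul_eq_mul]
  have hjΦ : ∀ k, ContDiff ℝ 1 fun p => j k (Φ p) := fun k => (hj k).comp hΦd
  have hρΦ : ContDiff ℝ 1 fun p => ρ (Φ p) := hρ.comp hΦd
  have hbd : ∀ k, ContDiff ℝ 1 fun p : Spacetime => β p.1 k * j k (Φ p) := fun k =>
    (hβkd k).mul (hjΦ k)
  -- `(ρ - β·j, V j)` is the pullback of the flux form along `Φ`; its divergence is `V` times that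
  -- of `(ρ, j)`, because the two terms `δ·j` cancel.
  have key := integral_density_le (J₀ := fun p => ρ (Φ p) - ∑ k, β p.1 k * j k (Φ p))
    (J := fun k p => V p * j k (Φ p)) (hρΦ.sub (ContDiff.sum fun k _ => hbd k))
    (fun k => hVd.mul (hjΦ k)) (fun p => ?_)
    -- The numerator bounds `|V| |x|` relative to `1 + |x|²`; the denominator comes from `ρ - β·j ≥
    -- (1 - max |βᵢ|) ρ`.
    (C := (|a₁ - a₀| + ‖δ‖) / (1 - max ‖β₀‖ ‖β₁‖)) ?_ (fun p hp => ?_)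
    (by simpa [hΦ, hβ, hδ] using hi₀) (by simpa [hΦ, hβ, hδ] using hi₁)
  · simpa [hΦ, hβ, hδ] using key
  · have e0 : fderiv ℝ (fun p => ρ (Φ p) - ∑ k, β p.1 k * j k (Φ p)) p (1, 0)
        = V p * fderiv ℝ ρ (Φ p) (1, 0) - ∑ k, (β p.1 k * (V p * fderiv ℝ (j k) (Φ p) (1, 0))
          + j k (Φ p) * δ k) := by
      rw [fderiv_fun_sub (hρΦ.differentiable one_ne_zero p)
        ((ContDiff.sum fun k _ => hbd k).differentiable one_ne_zero p),
        fderiv_fun_sum fun k _ => (hbd k).differentiable one_ne_zero p]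
      simp only [fderiv_fun_mul ((hβkd _).differentiable one_ne_zero p)
        ((hjΦ _).differentiable one_ne_zero p)]
      simp [hcomp hρ, hcomp (hj _), hβk, Prod.mk_zero_zero]
    have ek : ∀ k, fderiv ℝ (fun p => V p * j k (Φ p)) p (0, EuclideanSpace.single k 1)
        = V p * (β p.1 k * fderiv ℝ (j k) (Φ p) (1, 0)
          + fderiv ℝ (j k) (Φ p) (0, EuclideanSpace.single k 1))
          + j k (Φ p) * δ k := fun k => by
      rw [fderiv_fun_mul (hVd.differentiable one_ne_zero p)
        ((hjΦ k).differentiable one_ne_zero p)]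
      simp [hcomp (hj _), hVf, EuclideanSpace.inner_single_right]
    have h := hdiv (Φ p)
    rw [e0]
    simp only [ek, Fin.sum_univ_three] at h ⊢
    linear_combination V p * h
  · have : max ‖β₀‖ ‖β₁‖ < 1 := max_lt hβ₀ hβ₁
    exact div_nonneg (by positivity) (by linarith)
  · have hb : 0 < 1 - max ‖β₀‖ ‖β₁‖ := by linarith [max_lt hβ₀ hβ₁]
    -- Causality with a unit vector forces the density to be nonnegative.
    have hρ0 : 0 ≤ ρ (Φ p) := by
      have := (abs_nonneg _).trans (hcausal (Φ p) (EuclideanSpace.single 0 1))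
      simpa using this
    -- Balls are convex, so the interpolated slopes stay spacelike.
    have hβs : ‖β p.1‖ ≤ max ‖β₀‖ ‖β₁‖ := by
      have hmem := (convex_closedBall (0 : Space) (max ‖β₀‖ ‖β₁‖)).add_smul_sub_mem
        (x := β₀) (y := β₁) (by simp) (by simp) hp
      rw [← hδ] at hmem
      simpa using hmem
    have hlow : (1 - max ‖β₀‖ ‖β₁‖) * ρ (Φ p) ≤ ρ (Φ p) - ∑ k, β p.1 k * j k (Φ p) := by
      have h1 := (le_abs_self _).trans (hcausal (Φ p) (β p.1))
      have h2 := mul_le_mul_of_nonneg_right hβs hρ0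
      linarith
    have hVle : |V p| ≤ |a₁ - a₀| + ‖δ‖ * ‖p.2‖ :=
      (abs_add_le _ _).trans (add_le_add_right (abs_real_inner_le_norm _ _) _)
    calc |∑ k, p.2 k * (V p * j k (Φ p))| = |V p| * |∑ k, p.2 k * j k (Φ p)| := by
          rw [← abs_mul, Finset.mul_sum]
          congr 1
          exact Finset.sum_congr rfl fun k _ => by ring
      _ ≤ (|a₁ - a₀| + ‖δ‖ * ‖p.2‖) * (‖p.2‖ * ρ (Φ p)) := by
          gcongr
          exact hcausal (Φ p) p.2
      _ = ((|a₁ - a₀| + ‖δ‖ * ‖p.2‖) * ‖p.2‖) * ρ (Φ p) := by ring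
      _ ≤ ((|a₁ - a₀| + ‖δ‖) * (1 + ‖p.2‖ ^ 2)) * ρ (Φ p) := by
          refine mul_le_mul_of_nonneg_right ?_ hρ0
          nlinarith [mul_nonneg (norm_nonneg δ) (sq_nonneg (‖p.2‖ - 1)), norm_nonneg δ,
            mul_nonneg (abs_nonneg (a₁ - a₀)) (sq_nonneg (‖p.2‖ - 1)),
            mul_nonneg (abs_nonneg (a₁ - a₀)) (sq_nonneg ‖p.2‖)]
      _ = (|a₁ - a₀| + ‖δ‖) / (1 - max ‖β₀‖ ‖β₁‖) * (1 + ‖p.2‖ ^ 2)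
            * ((1 - max ‖β₀‖ ‖β₁‖) * ρ (Φ p)) := by
          field_simp
      _ ≤ _ := by gcongr

/-! ### Rotations and the parametrization of hyperplanes. -/

/-- The Rodrigues formula as a linear map. -/
noncomputable def rotateLinear (φ : Space) : Space →ₗ[ℝ] Space where
  toFun := rotate φ
  map_add' u v := by
    simp only [rotate, cross, WithLp.ofLp_add, map_add, WithLp.toLp_add, inner_add_right, mul_add,
      smul_add, add_smul]
    abel
  map_smul' r u := by
    simp only [rotate, cross, WithLp.ofLp_smul, map_smul, WithLp.toLp_smul, inner_smul_right,
      RingHom.id_apply]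
    module

/-- Expand the square using `n × u ⊥ u, n` and Lagrange's identity `|n × u|² = |n|²|u|² - (n·u)²`;
then `|n| = 1` and `sin² + cos² = 1` finish. The case `φ = 0` is separate, since there the
normalized axis is `0`. -/
theorem norm_rotate (φ u : Space) : ‖rotate φ u‖ = ‖u‖ := by
  rw [← sq_eq_sq₀ (norm_nonneg _) (norm_nonneg _)]
  rcases eq_or_ne φ 0 with rfl | hφ
  · simp [rotate]
  have hn : ‖‖φ‖⁻¹ • φ‖ ^ 2 = 1 := by
    rw [norm_smul, norm_inv, norm_norm, inv_mul_cancel₀ (norm_ne_zero_iff.2 hφ), one_pow]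
  have hcs := Real.sin_sq_add_cos_sq ‖φ‖
  simp only [rotate]
  generalize ‖φ‖⁻¹ • φ = n at hn ⊢
  generalize Real.cos ‖φ‖ = c at hcs ⊢
  generalize Real.sin ‖φ‖ = s at hcs ⊢
  simp only [EuclideanSpace.real_norm_sq_eq, Fin.sum_univ_three] at hn ⊢
  simp [cross, crossProduct, PiLp.inner_apply, Fin.sum_univ_three]
  linear_combination (u 0 ^ 2 + u 1 ^ 2 + u 2 ^ 2 - (n 0 * u 0 + n 1 * u 1 + n 2 * u 2) ^ 2) * hcs
    + (s ^ 2 * (u 0 ^ 2 + u 1 ^ 2 + u 2 ^ 2)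
      + (1 - c) ^ 2 * (n 0 * u 0 + n 1 * u 1 + n 2 * u 2) ^ 2) * hn

/-- `rotate φ` as a linear isometry equivalence. -/
noncomputable def rotateIsometry (φ : Space) : Space ≃ₗᵢ[ℝ] Space :=
  LinearIsometry.toLinearIsometryEquiv ⟨rotateLinear φ, norm_rotate φ⟩ rfl

theorem measurePreserving_add_rotate (y φ : Space) :
    MeasurePreserving (fun u => y + rotate φ u) volume volume :=
  (measurePreserving_add_left volume y).comp (rotateIsometry φ).measurePreserving

theorem measurableEmbedding_add_rotate (y φ : Space) :
    MeasurableEmbedding fun u => y + rotate φ u :=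
  ((rotateIsometry φ).toHomeomorph.trans (Homeomorph.addLeft y)).measurableEmbedding

/-- In the coordinate `x = y⃗ + R u` the plane is an affine graph with slope `α`. This change of
variables preserves volume, so the rotation drops out of the flux. -/
theorem hyperplane_eq_graph (lam : HyperplaneParam) (u : Space) :
    hyperplane lam u = (lam.y.1 - inner ℝ lam.α lam.y.2
      + inner ℝ lam.α (lam.y.2 + rotate lam.φ u), lam.y.2 + rotate lam.φ u) := by
  rw [hyperplane, inner_add_right]
  congr 1
  ring

theorem continuous_hyperplane (lam : HyperplaneParam) : Continuous (hyperplane lam) := by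
  have h : Continuous (rotate lam.φ) := (rotateIsometry lam.φ).continuous
  unfold hyperplane
  fun_prop

/-- A divergence-free causal current has the same flux through all spacelike hyperplanes through
which the flux is finite. -/
theorem integral_hyperplane_flux_eq {ρ : Spacetime → ℝ} {j : Fin 3 → Spacetime → ℝ}
    (hρ : ContDiff ℝ 1 ρ) (hj : ∀ k, ContDiff ℝ 1 (j k))
    (hdiv : ∀ p, fderiv ℝ ρ p (1, 0)
      + ∑ k, fderiv ℝ (j k) p (0, EuclideanSpace.single k 1) = 0)
    (hcausal : ∀ (p : Spacetime) (v : Space), |∑ k, v k * j k p| ≤ ‖v‖ * ρ p)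
    (hint : ∀ lam, Integrable fun u => ρ (hyperplane lam u)
      - ∑ k, lam.α k * j k (hyperplane lam u)) (lam lam' : HyperplaneParam) :
    ∫ u, (ρ (hyperplane lam u) - ∑ k, lam.α k * j k (hyperplane lam u))
      = ∫ u, (ρ (hyperplane lam' u) - ∑ k, lam'.α k * j k (hyperplane lam' u)) := by
  set g : HyperplaneParam → Space → ℝ := fun l x =>
    ρ (l.y.1 - inner ℝ l.α l.y.2 + inner ℝ l.α x, x)
      - ∑ k, l.α k * j k (l.y.1 - inner ℝ l.α l.y.2 + inner ℝ l.α x, x) with hg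
  have hcomp : ∀ l : HyperplaneParam, (fun u => ρ (hyperplane l u)
      - ∑ k, l.α k * j k (hyperplane l u)) = g l ∘ fun u => l.y.2 + rotate l.φ u := fun l => by
    funext u
    simp only [hg, Function.comp_apply, hyperplane_eq_graph]
  have hgi : ∀ l, Integrable (g l) := fun l =>
    ((measurePreserving_add_rotate l.y.2 l.φ).integrable_comp_emb
      (measurableEmbedding_add_rotate l.y.2 l.φ)).1 (hcomp l ▸ hint l)
  have hge : ∀ l : HyperplaneParam, ∫ u, (ρ (hyperplane l u)
      - ∑ k, l.α k * j k (hyperplane l u)) = ∫ x, g l x := fun l =>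
    (congrArg (fun f => ∫ u, f u) (hcomp l)).trans
      ((measurePreserving_add_rotate l.y.2 l.φ).integral_comp
        (measurableEmbedding_add_rotate l.y.2 l.φ) (g l))
  rw [hge, hge]
  -- The one-sided estimate is applied in both directions.
  exact le_antisymm
    (integral_graph_flux_le hρ hj hdiv hcausal lam'.norm_α_lt lam.norm_α_lt (hgi lam') (hgi lam))
    (integral_graph_flux_le hρ hj hdiv hcausal lam.norm_α_lt lam'.norm_α_lt (hgi lam) (hgi lam'))

/-! ### Algebra of the Dirac matrices. -/

theorem dotProduct_mulVec_eq_inner (M : Matrix (Fin 4) (Fin 4) ℂ) (f g : Spinor) :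
    star f.ofLp ⬝ᵥ (M *ᵥ g.ofLp) = inner ℂ f (toEuclideanCLM (n := Fin 4) (𝕜 := ℂ) M g) := by
  rw [EuclideanSpace.inner_eq_star_dotProduct, dotProduct_comm]
  rfl

theorem Matrix.IsHermitian.inner_toEuclideanCLM_left {M : Matrix (Fin 4) (Fin 4) ℂ}
    (hM : M.IsHermitian) (f g : Spinor) :
    inner ℂ (toEuclideanCLM (n := Fin 4) (𝕜 := ℂ) M f) g
      = inner ℂ f (toEuclideanCLM (n := Fin 4) (𝕜 := ℂ) M g) := by
  have h : ContinuousLinearMap.adjoint (toEuclideanCLM (n := Fin 4) (𝕜 := ℂ) M)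
      = toEuclideanCLM (n := Fin 4) (𝕜 := ℂ) M := by
    rw [← ContinuousLinearMap.star_eq_adjoint, ← map_star, star_eq_conjTranspose, hM.eq]
  rw [← ContinuousLinearMap.adjoint_inner_right (𝕜 := ℂ), h]

theorem Matrix.IsHermitian.inner_toEuclideanCLM_self_im {M : Matrix (Fin 4) (Fin 4) ℂ}
    (hM : M.IsHermitian) (f : Spinor) :
    (inner ℂ f (toEuclideanCLM (n := Fin 4) (𝕜 := ℂ) M f)).im = 0 := by
  have h := inner_conj_symm (𝕜 := ℂ) f (toEuclideanCLM (n := Fin 4) (𝕜 := ℂ) M f)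
  rw [hM.inner_toEuclideanCLM_left] at h
  exact Complex.conj_eq_iff_im.1 h

namespace IsDiracMatrices

variable {γ : GammaMatrices}

theorem gamma_zero_mul_self (hγ : IsDiracMatrices γ) : γ 0 * γ 0 = 1 := by
  have h := hγ.anticomm 0 0
  rw [← two_smul ℂ, mul_smul] at h
  simpa [minkowski] using smul_right_injective _ (two_ne_zero' ℂ) h

theorem gamma_succ_mul_gamma_zero (hγ : IsDiracMatrices γ) (k : Fin 3) :
    γ k.succ * γ 0 = -(γ 0 * γ k.succ) := by
  have h := hγ.anticomm 0 k.succ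
  rw [minkowski, Matrix.diagonal_apply_ne _ (Fin.succ_ne_zero k).symm, mul_zero, zero_smul] at h
  exact eq_neg_of_add_eq_zero_right h

theorem isHermitian_gamma_zero_mul (hγ : IsDiracMatrices γ) (μ : Fin 4) :
    (γ 0 * γ μ).IsHermitian := by
  refine Fin.cases ?_ (fun k => ?_) μ
  · rw [IsHermitian, conjTranspose_mul, hγ.hermitian_zero]
  · rw [IsHermitian, conjTranspose_mul, hγ.hermitian_zero, hγ.antihermitian_succ, neg_mul,
      hγ.gamma_succ_mul_gamma_zero, neg_neg]

theorem slash_mul_self (hγ : IsDiracMatrices γ) (v : Space) :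
    (∑ k : Fin 3, (v k : ℂ) • γ k.succ) * ∑ k : Fin 3, (v k : ℂ) • γ k.succ
      = -((‖v‖ ^ 2 : ℝ) : ℂ) • 1 := by
  have h : ∀ k l : Fin 3, γ k.succ * γ l.succ + γ l.succ * γ k.succ
      = (if k = l then (-2 : ℂ) else 0) • 1 := fun k l => by
    rw [hγ.anticomm, minkowski, Matrix.diagonal_apply]
    congr 1
    fin_cases k <;> fin_cases l <;> simp
  have e : ∀ k l : Fin 3, (v k : ℂ) • γ k.succ * (v l : ℂ) • γ l.succ
      + (v l : ℂ) • γ l.succ * (v k : ℂ) • γ k.succ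
      = ((v k : ℂ) * v l * (if k = l then (-2 : ℂ) else 0)) • 1 := fun k l => by
    rw [mul_smul ((v k : ℂ) * v l), ← h]
    simp only [smul_mul_smul_comm, smul_add, mul_comm (v l : ℂ)]
  -- The double sum is taken twice, with indices exchanged in the second copy, so that only
  -- anticommutators appear.
  refine smul_right_injective _ (two_ne_zero' ℂ) ?_
  simp only
  have hs := Finset.sum_mul_sum Finset.univ Finset.univ
    (fun k : Fin 3 => (v k : ℂ) • γ k.succ) fun k : Fin 3 => (v k : ℂ) • γ k.succ
  rw [two_smul]
  refine (congrArg₂ (· + ·) hs (hs.trans Finset.sum_comm)).trans ?_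
  simp only [← Finset.sum_add_distrib, e]
  simp only [← Finset.sum_smul, smul_smul]
  congr 1
  rw [EuclideanSpace.real_norm_sq_eq]
  simp [Fin.sum_univ_three]
  ring

theorem isHermitian_velocity (hγ : IsDiracMatrices γ) (v : Space) :
    (γ 0 * ∑ k : Fin 3, (v k : ℂ) • γ k.succ).IsHermitian := by
  rw [Finset.mul_sum, IsHermitian, conjTranspose_sum]
  refine Finset.sum_congr rfl fun k _ => ?_
  rw [mul_smul_comm, conjTranspose_smul, (hγ.isHermitian_gamma_zero_mul k.succ).eq]
  simp

theorem velocity_mul_self (hγ : IsDiracMatrices γ) (v : Space) :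
    (γ 0 * ∑ k : Fin 3, (v k : ℂ) • γ k.succ) * (γ 0 * ∑ k : Fin 3, (v k : ℂ) • γ k.succ)
      = ((‖v‖ ^ 2 : ℝ) : ℂ) • 1 := by
  have h : (∑ k : Fin 3, (v k : ℂ) • γ k.succ) * γ 0
      = -(γ 0 * ∑ k : Fin 3, (v k : ℂ) • γ k.succ) := by
    rw [Finset.sum_mul, Finset.mul_sum, ← Finset.sum_neg_distrib]
    refine Finset.sum_congr rfl fun k _ => ?_
    rw [smul_mul_assoc, hγ.gamma_succ_mul_gamma_zero, mul_smul_comm, smul_neg]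
  rw [mul_assoc, ← mul_assoc _ (γ 0), h, neg_mul, mul_assoc, hγ.slash_mul_self, mul_neg,
    ← mul_assoc, hγ.gamma_zero_mul_self, one_mul, neg_smul, neg_neg]

/-- A Hermitian matrix with square `|v|²` multiplies every norm by `|v|`. This is the source of
causality. -/
theorem norm_velocity_apply (hγ : IsDiracMatrices γ) (v : Space) (f : Spinor) :
    ‖toEuclideanCLM (n := Fin 4) (𝕜 := ℂ) (γ 0 * ∑ k : Fin 3, (v k : ℂ) • γ k.succ) f‖
      = ‖v‖ * ‖f‖ := by
  rw [← sq_eq_sq₀ (norm_nonneg _) (by positivity), mul_pow,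
    @norm_sq_eq_re_inner ℂ, (hγ.isHermitian_velocity v).inner_toEuclideanCLM_left,
    ← mul_apply_eq_comp, ← map_mul, hγ.velocity_mul_self, map_smul, map_one,
    @norm_sq_eq_re_inner ℂ _ _ _ _ f]
  simp [← Complex.ofReal_pow]

theorem abs_velocity_inner_le (hγ : IsDiracMatrices γ) (v : Space) (f : Spinor) :
    |(star f.ofLp ⬝ᵥ ((γ 0 * ∑ k : Fin 3, (v k : ℂ) • γ k.succ) *ᵥ f.ofLp)).re|
      ≤ ‖v‖ * ‖f‖ ^ 2 := by
  rw [dotProduct_mulVec_eq_inner]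
  refine (Complex.abs_re_le_norm _).trans ((norm_inner_le_norm _ _).trans_eq ?_)
  rw [hγ.norm_velocity_apply]
  ring

end IsDiracMatrices

/-! ### The Dirac current: causality and conservation. -/

theorem current_zero_self {γ : GammaMatrices} (hγ : IsDiracMatrices γ) (Ψ : Spacetime → Spinor)
    (x : Spacetime) : (current γ Ψ Ψ 0 x).re = ‖Ψ x‖ ^ 2 := by
  rw [current, hγ.gamma_zero_mul_self, dotProduct_mulVec_eq_inner, map_one]
  exact (@norm_sq_eq_re_inner ℂ _ _ _ _ (Ψ x)).symm

theorem sum_mul_current_succ (γ : GammaMatrices) (ΨA ΨB : Spacetime → Spinor) (v : Space)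
    (x : Spacetime) : ∑ k : Fin 3, (v k : ℂ) * current γ ΨA ΨB k.succ x
      = star (ΨA x).ofLp ⬝ᵥ ((γ 0 * ∑ k : Fin 3, (v k : ℂ) • γ k.succ) *ᵥ (ΨB x).ofLp) := by
  simp only [current, Finset.mul_sum, Matrix.sum_mulVec, dotProduct_sum, mul_smul_comm,
    smul_mulVec, dotProduct_smul, smul_eq_mul]

theorem abs_sum_mul_current_succ_le {γ : GammaMatrices} (hγ : IsDiracMatrices γ)
    (Ψ : Spacetime → Spinor) (x : Spacetime) (v : Space) :
    |∑ k : Fin 3, v k * (current γ Ψ Ψ k.succ x).re| ≤ ‖v‖ * (current γ Ψ Ψ 0 x).re := by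
  rw [current_zero_self hγ]
  convert hγ.abs_velocity_inner_le v (Ψ x) using 2
  rw [← sum_mul_current_succ γ Ψ Ψ v x, Complex.re_sum]
  simp only [Complex.re_ofReal_mul]

theorem fluxDensity_current {γ : GammaMatrices} (hγ : IsDiracMatrices γ)
    (ΨA ΨB : Spacetime → Spinor) (lam : HyperplaneParam) (u : Space) :
    fluxDensity (current γ ΨA ΨB) lam u
      = braketDensity γ lam.α ((ΨA ∘ hyperplane lam) u) ((ΨB ∘ hyperplane lam) u) := by
  rw [fluxDensity, Fin.sum_univ_succ, braketDensity, sub_mulVec, dotProduct_sub]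
  simp only [Function.comp_apply, ← sum_mul_current_succ]
  simp [surfaceCovector, current, hγ.gamma_zero_mul_self, sub_eq_add_neg, mul_comm]

theorem contDiff_re_current (γ : GammaMatrices) {Ψ : Spacetime → Spinor} (hΨ : ContDiff ℝ 1 Ψ)
    (μ : Fin 4) : ContDiff ℝ 1 fun x => (current γ Ψ Ψ μ x).re := by
  simp only [current, dotProduct_mulVec_eq_inner]
  exact Complex.reCLM.contDiff.comp (hΨ.inner ℂ
    (((toEuclideanCLM (n := Fin 4) (𝕜 := ℂ) (γ 0 * γ μ)).restrictScalars ℝ).contDiff.comp hΨ))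

theorem fderiv_re_current {γ : GammaMatrices} (hγ : IsDiracMatrices γ) {Ψ : Spacetime → Spinor}
    (hΨ : ContDiff ℝ 1 Ψ) (μ : Fin 4) (x v : Spacetime) :
    fderiv ℝ (fun x => (current γ Ψ Ψ μ x).re) x v
      = 2 * (inner ℂ (Ψ x)
        (toEuclideanCLM (n := Fin 4) (𝕜 := ℂ) (γ 0 * γ μ) (fderiv ℝ Ψ x v))).re := by
  simp only [current, dotProduct_mulVec_eq_inner]
  have hd := hΨ.differentiable one_ne_zero x
  set L := toEuclideanCLM (n := Fin 4) (𝕜 := ℂ) (γ 0 * γ μ) with hL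
  have hLd : HasFDerivAt (fun x => L (Ψ x)) ((L.restrictScalars ℝ).comp (fderiv ℝ Ψ x)) x :=
    (L.restrictScalars ℝ).hasFDerivAt.comp x hd.hasFDerivAt
  have h : HasFDerivAt (fun x => (inner ℂ (Ψ x) (L (Ψ x))).re) _ x :=
    Complex.reCLM.hasFDerivAt.comp x (hd.hasFDerivAt.inner ℂ hLd)
  -- Hermiticity of `γ⁰ γ^μ` makes the two product-rule terms have equal real parts.
  have hs : (inner ℂ (fderiv ℝ Ψ x v) (L (Ψ x))).re = (inner ℂ (Ψ x) (L (fderiv ℝ Ψ x v))).re := by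
    rw [← (hγ.isHermitian_gamma_zero_mul μ).inner_toEuclideanCLM_left, ← hL]
    exact inner_re_symm (𝕜 := ℂ) (L (fderiv ℝ Ψ x v)) (Ψ x)
  rw [h.fderiv]
  simp [fderivInnerCLM_apply, hs]
  ring

/-- Multiply the Dirac equation by `Ψ⁺ γ⁰` and take imaginary parts. The potential and mass terms
are real, as `γ⁰ γ^μ` and `γ⁰` are Hermitian with real coefficients; what remains is half the
divergence. -/
theorem DiracEquation.div_current_eq_zero {γ : GammaMatrices} (hγ : IsDiracMatrices γ)
    {e c ħ m : ℝ} {A : Spacetime → Fin 4 → ℝ} {Ψ : Spacetime → Spinor} (hΨ : ContDiff ℝ 1 Ψ)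
    (hD : DiracEquation γ e c ħ m A Ψ) (x : Spacetime) :
    fderiv ℝ (fun x => (current γ Ψ Ψ 0 x).re) x (1, 0) + ∑ k : Fin 3,
      fderiv ℝ (fun x => (current γ Ψ Ψ k.succ x).re) x (0, EuclideanSpace.single k 1) = 0 := by
  simp only [fderiv_re_current hγ hΨ]
  have h := congrArg (fun w => star (Ψ x).ofLp ⬝ᵥ (γ 0 *ᵥ w)) (hD x)
  simp only [mulVec_sub, mulVec_smul, mulVec_sum, mulVec_mulVec, dotProduct_sub, dotProduct_smul,
    dotProduct_sum, mulVec_zero, dotProduct_zero, dotProduct_mulVec_eq_inner, smul_eq_mul,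
    mulVec_mulVec] at h
  have h' := congrArg Complex.im h
  have h0 : (γ 0).IsHermitian := hγ.hermitian_zero
  simp only [Complex.sub_im, Complex.im_sum, Complex.im_ofReal_mul, Complex.I_mul_im,
    (hγ.isHermitian_gamma_zero_mul _).inner_toEuclideanCLM_self_im,
    h0.inner_toEuclideanCLM_self_im, mul_zero, Finset.sum_const_zero, sub_zero,
    Complex.zero_im] at h'
  rw [Fin.sum_univ_succ] at h'
  rw [← Finset.mul_sum, ← mul_add]
  exact mul_eq_zero_of_right _ h'

/-! ### The sesquilinear density: bounds and polarization. -/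

theorem braketDensity_add_left (γ : GammaMatrices) (α : Space) (f f' g : Spinor) :
    braketDensity γ α (f + f') g = braketDensity γ α f g + braketDensity γ α f' g := by
  simp [braketDensity, add_dotProduct]

theorem braketDensity_add_right (γ : GammaMatrices) (α : Space) (f g g' : Spinor) :
    braketDensity γ α f (g + g') = braketDensity γ α f g + braketDensity γ α f g' := by
  simp [braketDensity, mulVec_add, dotProduct_add]

theorem braketDensity_smul_left (γ : GammaMatrices) (α : Space) (z : ℂ) (f g : Spinor) :
    braketDensity γ α (z • f) g = star z * braketDensity γ α f g := by
  simp [braketDensity, star_smul, smul_dotProduct]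

theorem norm_braketDensity_le (γ : GammaMatrices) (α : Space) :
    ∃ K, ∀ f g, ‖braketDensity γ α f g‖ ≤ K * (‖f‖ ^ 2 + ‖g‖ ^ 2) := by
  set M := toEuclideanCLM (n := Fin 4) (𝕜 := ℂ) (1 - γ 0 * ∑ k : Fin 3, (α k : ℂ) • γ k.succ)
    with hM
  refine ⟨‖M‖, fun f g => ?_⟩
  rw [braketDensity, dotProduct_mulVec_eq_inner, ← hM]
  calc ‖(inner ℂ f (M g) : ℂ)‖ ≤ ‖f‖ * (‖M‖ * ‖g‖) :=
        (norm_inner_le_norm _ _).trans (by gcongr; exact M.le_opNorm g)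
    _ = ‖M‖ * (‖f‖ * ‖g‖) := by ring
    _ ≤ ‖M‖ * (‖f‖ ^ 2 + ‖g‖ ^ 2) := by
        gcongr
        nlinarith [sq_nonneg (‖f‖ - ‖g‖), sq_nonneg ‖f‖, sq_nonneg ‖g‖]

theorem continuous_braketDensity (γ : GammaMatrices) (α : Space) {f g : Space → Spinor}
    (hf : Continuous f) (hg : Continuous g) :
    Continuous fun u => braketDensity γ α (f u) (g u) := by
  simp only [braketDensity, dotProduct_mulVec_eq_inner]
  exact hf.inner ((ContinuousLinearMap.continuous _).comp hg)

theorem integrable_braketDensity (γ : GammaMatrices) (α : Space) {f g : Space → Spinor}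
    (hf : Continuous f) (hg : Continuous g) (hfi : Integrable fun u => ‖f u‖ ^ 2)
    (hgi : Integrable fun u => ‖g u‖ ^ 2) :
    Integrable fun u => braketDensity γ α (f u) (g u) := by
  obtain ⟨K, hK⟩ := norm_braketDensity_le γ α
  exact ((hfi.add hgi).const_mul K).mono' (continuous_braketDensity γ α hf hg).aestronglyMeasurable
    (.of_forall fun u => hK _ _)

namespace IsDiracMatrices

variable {γ : GammaMatrices}

theorem star_braketDensity (hγ : IsDiracMatrices γ) (α : Space) (f g : Spinor) :
    star (braketDensity γ α f g) = braketDensity γ α g f := by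
  simp only [braketDensity, dotProduct_mulVec_eq_inner]
  rw [← (isHermitian_one.sub (hγ.isHermitian_velocity α)).inner_toEuclideanCLM_left g f]
  exact inner_conj_symm (𝕜 := ℂ) _ _

/-- Coercivity for `|α| < 1`: it turns a finite hyperplane norm into ordinary square integrability.
-/
theorem le_braketDensity_self_re (hγ : IsDiracMatrices γ) (α : Space) (f : Spinor) :
    (1 - ‖α‖) * ‖f‖ ^ 2 ≤ (braketDensity γ α f f).re := by
  have h := (le_abs_self _).trans (hγ.abs_velocity_inner_le α f)
  have h1 : (star f.ofLp ⬝ᵥ ((1 : Matrix (Fin 4) (Fin 4) ℂ) *ᵥ f.ofLp)).re = ‖f‖ ^ 2 := by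
    rw [dotProduct_mulVec_eq_inner, map_one]
    exact (@norm_sq_eq_re_inner ℂ _ _ _ _ f).symm
  rw [braketDensity, sub_mulVec, dotProduct_sub, Complex.sub_re, h1]
  linarith

theorem two_mul_re_braketDensity (hγ : IsDiracMatrices γ) (α : Space) (f g : Spinor) :
    2 * (braketDensity γ α f g).re = (braketDensity γ α (f + g) (f + g)).re
      - (braketDensity γ α f f).re - (braketDensity γ α g g).re := by
  have h := congrArg Complex.re (hγ.star_braketDensity α f g)
  simp only [braketDensity_add_left, braketDensity_add_right, Complex.add_re, ← h,
    Complex.star_def, Complex.conj_re]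
  ring

end IsDiracMatrices

/-- The form is conjugate-linear on the left, and `Re (-i z) = Im z`. -/
theorem im_braketDensity (γ : GammaMatrices) (α : Space) (f g : Spinor) :
    (braketDensity γ α f g).im = (braketDensity γ α (Complex.I • f) g).re := by
  simp [braketDensity_smul_left]

/-! ### Conservation of the bracket for pairs of solutions. -/

/-- Solutions of the Dirac equation that are square integrable on every hyperplane. -/
structure IsSquareIntegrableSolution (γ : GammaMatrices) (e c ħ m : ℝ) (A : Spacetime → Fin 4 → ℝ)
    (Ψ : Spacetime → Spinor) : Prop where
  contDiff : ContDiff ℝ 1 Ψ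
  dirac : DiracEquation γ e c ħ m A Ψ
  integrable : ∀ lam, Integrable fun u => ‖Ψ (hyperplane lam u)‖ ^ 2

section Conservation

variable {γ : GammaMatrices} {e c ħ m : ℝ} {A : Spacetime → Fin 4 → ℝ} {Ψ Ψ' : Spacetime → Spinor}

theorem MemHHat.isSquareIntegrableSolution (hγ : IsDiracMatrices γ) (h : MemHHat γ e c ħ m A Ψ) :
    IsSquareIntegrableSolution γ e c ħ m A Ψ where
  contDiff := h.contDiff
  dirac := h.dirac
  integrable lam := by
    have hc : Continuous (Ψ ∘ hyperplane lam) :=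
      h.contDiff.continuous.comp (continuous_hyperplane lam)
    have hα : 0 < 1 - ‖lam.α‖ := by linarith [lam.norm_α_lt]
    have hle := hγ.le_braketDensity_self_re lam.α
    have hi : Integrable fun u => (braketDensity γ lam.α ((Ψ ∘ hyperplane lam) u)
        ((Ψ ∘ hyperplane lam) u)).re := by
      refine ⟨(Complex.continuous_re.comp
        (continuous_braketDensity γ lam.α hc hc)).aestronglyMeasurable, ?_⟩
      rw [hasFiniteIntegral_iff_ofReal
        (.of_forall fun u => (mul_nonneg hα.le (sq_nonneg _)).trans (hle _))]
      exact (ENNReal.rpow_lt_top_iff_of_pos (by norm_num)).1 (h.norm_lt_top lam)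
    refine (hi.const_mul (1 - ‖lam.α‖)⁻¹).mono' (hc.norm.pow 2).aestronglyMeasurable
      (.of_forall fun u => ?_)
    rw [Real.norm_of_nonneg (sq_nonneg _), le_inv_mul_iff₀ hα]
    exact hle _

namespace IsSquareIntegrableSolution

theorem continuous_comp (h : IsSquareIntegrableSolution γ e c ħ m A Ψ) (lam : HyperplaneParam) :
    Continuous fun u => Ψ (hyperplane lam u) :=
  h.contDiff.continuous.comp (continuous_hyperplane lam)

/-- Polarization applies the single-solution result to `Ψ + Ψ'`, so the class must be closed under
sums. -/
theorem add (h : IsSquareIntegrableSolution γ e c ħ m A Ψ)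
    (h' : IsSquareIntegrableSolution γ e c ħ m A Ψ') :
    IsSquareIntegrableSolution γ e c ħ m A (Ψ + Ψ') where
  contDiff := h.contDiff.add h'.contDiff
  dirac x := by
    have hp : ∀ μ, partialDeriv μ (Ψ + Ψ') x = partialDeriv μ Ψ x + partialDeriv μ Ψ' x := fun μ => by
      simp [partialDeriv, fderiv_add (h.contDiff.differentiable one_ne_zero x)
        (h'.contDiff.differentiable one_ne_zero x)]
    have e1 := congrArg₂ (· + ·) (h.dirac x) (h'.dirac x)
    simp only [add_zero] at e1
    rw [← e1]
    simp only [hp, Pi.add_apply, WithLp.ofLp_add, mulVec_add, smul_add, Finset.sum_add_distrib]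
    abel
  integrable lam := by
    refine (((h.integrable lam).add (h'.integrable lam)).const_mul 2).mono'
      (((h.continuous_comp lam).add (h'.continuous_comp lam)).norm.pow 2).aestronglyMeasurable
      (.of_forall fun u => ?_)
    rw [Real.norm_of_nonneg (sq_nonneg _)]
    calc ‖Ψ (hyperplane lam u) + Ψ' (hyperplane lam u)‖ ^ 2
        ≤ (‖Ψ (hyperplane lam u)‖ + ‖Ψ' (hyperplane lam u)‖) ^ 2 := by
          gcongr
          exact norm_add_le _ _
      _ ≤ _ := add_sq_le

theorem const_smul (h : IsSquareIntegrableSolution γ e c ħ m A Ψ) (z : ℂ) :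
    IsSquareIntegrableSolution γ e c ħ m A (z • Ψ) where
  contDiff := contDiff_const.smul h.contDiff
  dirac x := by
    have hp : ∀ μ, partialDeriv μ (z • Ψ) x = z • partialDeriv μ Ψ x := fun μ => by
      simp [partialDeriv, fderiv_const_smul (h.contDiff.differentiable one_ne_zero x)]
    have e1 := congrArg (z • ·) (h.dirac x)
    simp only [smul_zero] at e1
    rw [← e1]
    simp only [hp, Pi.smul_apply, WithLp.ofLp_smul, mulVec_smul, smul_sub, Finset.smul_sum,
      smul_comm z]
  integrable lam := by
    simpa [norm_smul, mul_pow] using (h.integrable lam).const_mul (‖z‖ ^ 2)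

theorem integrable_braketDensity (h : IsSquareIntegrableSolution γ e c ħ m A Ψ)
    (h' : IsSquareIntegrableSolution γ e c ħ m A Ψ') (lam : HyperplaneParam) :
    Integrable fun u =>
      braketDensity γ lam.α (Ψ (hyperplane lam u)) (Ψ' (hyperplane lam u)) :=
  _root_.integrable_braketDensity γ lam.α (h.continuous_comp lam) (h'.continuous_comp lam)
    (h.integrable lam) (h'.integrable lam)

theorem integral_re_braketDensity_self_eq (hγ : IsDiracMatrices γ)
    (h : IsSquareIntegrableSolution γ e c ħ m A Ψ) (lam lam' : HyperplaneParam) :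
    ∫ u, (braketDensity γ lam.α (Ψ (hyperplane lam u)) (Ψ (hyperplane lam u))).re
      = ∫ u, (braketDensity γ lam'.α (Ψ (hyperplane lam' u)) (Ψ (hyperplane lam' u))).re := by
  have hd : ∀ (l : HyperplaneParam) (u : Space),
      (braketDensity γ l.α (Ψ (hyperplane l u)) (Ψ (hyperplane l u))).re
        = (current γ Ψ Ψ 0 (hyperplane l u)).re
          - ∑ k : Fin 3, l.α k * (current γ Ψ Ψ k.succ (hyperplane l u)).re := fun l u => by
    refine (congrArg Complex.re (fluxDensity_current hγ Ψ Ψ l u)).symm.trans ?_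
    rw [fluxDensity, Fin.sum_univ_succ]
    simp [surfaceCovector, sub_eq_add_neg, mul_comm]
  simp only [hd]
  refine integral_hyperplane_flux_eq (ρ := fun x => (current γ Ψ Ψ 0 x).re)
    (j := fun k x => (current γ Ψ Ψ k.succ x).re) (contDiff_re_current γ h.contDiff 0)
    (fun k => contDiff_re_current γ h.contDiff k.succ)
    (h.dirac.div_current_eq_zero hγ h.contDiff) (abs_sum_mul_current_succ_le hγ Ψ)
    (fun l => ?_) lam lam'
  exact (integrable_congr (.of_forall (hd l))).1 (h.integrable_braketDensity h l).re

theorem integral_re_braketDensity_eq (hγ : IsDiracMatrices γ)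
    (h : IsSquareIntegrableSolution γ e c ħ m A Ψ)
    (h' : IsSquareIntegrableSolution γ e c ħ m A Ψ') (lam lam' : HyperplaneParam) :
    ∫ u, (braketDensity γ lam.α (Ψ (hyperplane lam u)) (Ψ' (hyperplane lam u))).re
      = ∫ u, (braketDensity γ lam'.α (Ψ (hyperplane lam' u)) (Ψ' (hyperplane lam' u))).re := by
  have hp : ∀ l : HyperplaneParam,
      2 * ∫ u, (braketDensity γ l.α (Ψ (hyperplane l u)) (Ψ' (hyperplane l u))).re
        = (∫ u, (braketDensity γ l.α ((Ψ + Ψ') (hyperplane l u)) ((Ψ + Ψ') (hyperplane l u))).re)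
          - (∫ u, (braketDensity γ l.α (Ψ (hyperplane l u)) (Ψ (hyperplane l u))).re)
          - ∫ u, (braketDensity γ l.α (Ψ' (hyperplane l u)) (Ψ' (hyperplane l u))).re := fun l => by
    have i1 := ((h.add h').integrable_braketDensity (h.add h') l).re
    have i2 := (h.integrable_braketDensity h l).re
    have i3 := (h'.integrable_braketDensity h' l).re
    simp only [RCLike.re_to_complex] at i1 i2 i3
    rw [← integral_const_mul, ← integral_sub i1 i2]
    refine Eq.trans ?_ (integral_sub (i1.sub i2) i3)
    simp only [hγ.two_mul_re_braketDensity, Pi.add_apply]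
  -- Each of the three diagonal integrals is independent of the hyperplane.
  have e1 := hp lam
  rw [(h.add h').integral_re_braketDensity_self_eq hγ lam lam',
    h.integral_re_braketDensity_self_eq hγ lam lam',
    h'.integral_re_braketDensity_self_eq hγ lam lam', ← hp lam'] at e1
  exact mul_left_cancel₀ two_ne_zero e1

theorem braket_eq (hγ : IsDiracMatrices γ) (h : IsSquareIntegrableSolution γ e c ħ m A Ψ)
    (h' : IsSquareIntegrableSolution γ e c ħ m A Ψ') (lam lam' : HyperplaneParam) :
    braket γ lam (Ψ ∘ hyperplane lam) (Ψ' ∘ hyperplane lam)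
      = braket γ lam' (Ψ ∘ hyperplane lam') (Ψ' ∘ hyperplane lam') := by
  have hre : ∀ l : HyperplaneParam, (braket γ l (Ψ ∘ hyperplane l) (Ψ' ∘ hyperplane l)).re
      = ∫ u, (braketDensity γ l.α (Ψ (hyperplane l u)) (Ψ' (hyperplane l u))).re := fun l =>
    (integral_re (h.integrable_braketDensity h' l)).symm
  have him : ∀ l : HyperplaneParam, (braket γ l (Ψ ∘ hyperplane l) (Ψ' ∘ hyperplane l)).im
      = ∫ u, (braketDensity γ l.α ((Complex.I • Ψ) (hyperplane l u))
        (Ψ' (hyperplane l u))).re := fun l => by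
    refine (integral_im (h.integrable_braketDensity h' l)).symm.trans ?_
    exact integral_congr_ae (.of_forall fun u => im_braketDensity _ _ _ _)
  apply Complex.ext
  · rw [hre, hre, h.integral_re_braketDensity_eq hγ h' lam lam']
  · rw [him, him, (h.const_smul Complex.I).integral_re_braketDensity_eq hγ h' lam lam']

end IsSquareIntegrableSolution

end Conservation

theorem theorem1 (γ : GammaMatrices) (hγ : IsDiracMatrices γ)
    (e c ħ m : ℝ) (hc : 0 < c) (hħ : 0 < ħ) (A : Spacetime → Fin 4 → ℝ)
    (ΨA ΨB : Spacetime → Spinor)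
    (hA : MemHHat γ e c ħ m A ΨA) (hB : MemHHat γ e c ħ m A ΨB) :
    (∀ lam : HyperplaneParam,
      Integrable (fluxDensity (current γ ΨA ΨB) lam) volume ∧
      Integrable (fun u => braketDensity γ lam.α
        ((ΨA ∘ hyperplane lam) u) ((ΨB ∘ hyperplane lam) u)) volume ∧
      braket γ lam (ΨA ∘ hyperplane lam) (ΨB ∘ hyperplane lam)
        = flux (current γ ΨA ΨB) lam) ∧
    (∀ lam lam' : HyperplaneParam,
      flux (current γ ΨA ΨB) lam = flux (current γ ΨA ΨB) lam') ∧
    (∀ lam lam' : HyperplaneParam,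
      braket γ lam (ΨA ∘ hyperplane lam) (ΨB ∘ hyperplane lam)
        = braket γ lam' (ΨA ∘ hyperplane lam') (ΨB ∘ hyperplane lam')) := by
  have sA := hA.isSquareIntegrableSolution hγ
  have sB := hB.isSquareIntegrableSolution hγ
  have hflux : ∀ lam, fluxDensity (current γ ΨA ΨB) lam = fun u => braketDensity γ lam.α
      ((ΨA ∘ hyperplane lam) u) ((ΨB ∘ hyperplane lam) u) := fun lam =>
    funext fun u => fluxDensity_current hγ ΨA ΨB lam u
  have hint := sA.integrable_braketDensity sB
  have heq : ∀ lam, braket γ lam (ΨA ∘ hyperplane lam) (ΨB ∘ hyperplane lam)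
      = flux (current γ ΨA ΨB) lam := fun lam => by rw [flux, hflux, braket]
  refine ⟨fun lam => ⟨hflux lam ▸ hint lam, hint lam, heq lam⟩, fun lam lam' => ?_,
    sA.braket_eq hγ sB⟩
  rw [← heq, ← heq, sA.braket_eq hγ sB lam lam']
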